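/- Let $(X,\mu)$ be a non-atomic measure space (every measurable set of positive measure has a measurable subset of strictly smaller positive measure). For a measurable function $g$ on $X$ with values in the scalars or in $[0,\infty]$, let $g^*(t)=\inf\{\alpha\ge 0:\mu(\{|g|>\alpha\})\le t\}$ be its nonincreasing rearrangement and, for $0<p<\infty$, let $$\|g\|_{p,r}=\Big(\frac rp\int_0^\infty [t^{1/p}g^*(t)]^r\,\frac{dt}{t}\Big)^{1/r}\quad(0<r<\infty),\qquad \|g\|_{p,\infty}=\sup_{t>0}t^{1/p}g^*(t).$$ For a finite or countable family $f=(f_k)$ of real or complex valued measurable functions on $X$ and $0<q\le\infty$ put $$\|f\|_{L^{p,r}(\ell^q)}=\Big\|\Big(\sum_k|f_k|^q\Big)^{1/q}\Big\|_{p,r},\qquad \|f\|_{\ell^q(L^{p,r})}=\Big(\sum_k\|f_k\|_{p,r}^q\Big)^{1/q},$$ with suprema over $k$ in place of the sums when $q=\infty$. Let $0<p<\infty$, $0<q_0,q_1,r_0,r_1\le\infty$, and assume $q_0\le\min\{p,q_1,r_1\}$ and $r_0\le r_1$. Then the embedding $$\ell^{q_0}(L^{p,r_0})\hookrightarrow L^{p,r_1}(\ell^{q_1})$$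 holds in each of the following three cases: (i) $p\neq q_1$; (ii) $p=q_1\ge r_0$; (iii) $q_0<p=q_1<r_0$. That is, there is a finite constant $C$, depending only on $p,q_0,q_1,r_0,r_1$, such that for all such $(X,\mu)$ and $f$, $$\|f\|_{L^{p,r_1}(\ell^{q_1})}\le C\,\|f\|_{\ell^{q_0}(L^{p,r_0})}.$$ -/

import Mathlib

open MeasureTheory
open scoped ENNReal NNReal

namespace LorentzSeq

/-- `μ` is non-atomic: every measurable set of positive measure has a measurable subset of strictly
smaller positive measure. (This is not Mathlib's `NoAtoms`, which only concerns singletons.) -/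
def IsNonatomic {X : Type*} [MeasurableSpace X] (μ : Measure X) : Prop :=
  ∀ s : Set X, MeasurableSet s → 0 < μ s →
    ∃ t : Set X, t ⊆ s ∧ MeasurableSet t ∧ 0 < μ t ∧ μ t < μ s

/-- The distribution function `μ_g(α) = μ {x | g x > α}`. Functions are taken with values in
`[0, ∞]`; a scalar function `f` is represented by its modulus `x ↦ ‖f x‖ₑ`. -/
noncomputable def distribution {X : Type*} [MeasurableSpace X] (μ : Measure X)
    (g : X → ℝ≥0∞) (α : ℝ≥0∞) : ℝ≥0∞ :=
  μ {x | α < g x}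

/-- The nonincreasing rearrangement `g^*(t) = inf {α | μ_g(α) ≤ t}`, with value `∞` if no finite
`α` qualifies. -/
noncomputable def rearrangement {X : Type*} [MeasurableSpace X] (μ : Measure X)
    (g : X → ℝ≥0∞) (t : ℝ≥0∞) : ℝ≥0∞ :=
  sInf {α : ℝ≥0∞ | distribution μ g α ≤ t}

/-- The Lorentz quasi-norm, for `0 < p < ∞`:
`‖g‖_{p,r} = ((r/p) ∫_0^∞ (t^{1/p} g^*(t))^r dt/t)^{1/r}` if `0 < r < ∞`, and
`‖g‖_{p,∞} = sup_{t > 0} t^{1/p} g^*(t)`. -/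
noncomputable def lorentzNorm {X : Type*} [MeasurableSpace X] (μ : Measure X) (p r : ℝ≥0∞)
    (g : X → ℝ≥0∞) : ℝ≥0∞ :=
  if r = ∞ then
    ⨆ (t : ℝ) (_ : 0 < t), ENNReal.ofReal t ^ (1 / p.toReal) * rearrangement μ g (ENNReal.ofReal t)
  else
    (r / p * ∫⁻ t in Set.Ioi (0 : ℝ),
      (ENNReal.ofReal t ^ (1 / p.toReal) * rearrangement μ g (ENNReal.ofReal t)) ^ r.toReal
        / ENNReal.ofReal t) ^ (1 / r.toReal)

/-- The `ℓ^q` quasi-norm, `0 < q ≤ ∞`, of a family of elements of `[0, ∞]`. -/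
noncomputable def ellNorm {ι : Type*} (q : ℝ≥0∞) (a : ι → ℝ≥0∞) : ℝ≥0∞ :=
  if q = ∞ then ⨆ k, a k else (∑' k, a k ^ q.toReal) ^ (1 / q.toReal)

/-- The quasi-norm of `f = (f_k)` in `ℓ^q(L^{p,r})`. -/
noncomputable def ellLorentzNorm {X ι 𝕜 : Type*} [MeasurableSpace X] [RCLike 𝕜] (μ : Measure X)
    (q p r : ℝ≥0∞) (f : ι → X → 𝕜) : ℝ≥0∞ :=
  ellNorm q fun k => lorentzNorm μ p r fun x => ‖f k x‖ₑ

/-- The quasi-norm of `f = (f_k)` in `L^{p,r}(ℓ^q)`. -/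
noncomputable def lorentzEllNorm {X ι 𝕜 : Type*} [MeasurableSpace X] [RCLike 𝕜] (μ : Measure X)
    (p r q : ℝ≥0∞) (f : ι → X → 𝕜) : ℝ≥0∞ :=
  lorentzNorm μ p r fun x => ellNorm q fun k => ‖f k x‖ₑ

end LorentzSeq

namespace LorentzSeq

open Set

/-! ### Distribution functions and rearrangements. -/

section Rearrangement

variable {X : Type*} [MeasurableSpace X] {μ : Measure X}

/-! Since `ℓ^q` decreases in norm as `q` grows and `L^{p,r}` embeds in `L^{p,s}` for `r ≤ s`, it is
enough to bound `L^{p,r}(ℓ^q)` by `ℓ^{q₀}(L^{p,r})` for one `q ≤ q₁` and one `r ∈ [r₀, r₁]`. The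
choice depends on how `q₀ ≤ p` and `q₀ ≤ q₁` hold.

If `q₀ < p`, take `q = q₀`, `r = r₁`. After raising to the power `q₀` the claim is a countable
triangle inequality in `L^{p/q₀, r₁/q₀}`, whose exponents are `> 1` and `≥ 1`. Cutting each summand
at its own level `h_k^*(t)` and applying Chebyshev to the excess (`rearrangement_tsum_le`) bounds
the rearrangement of the sum by `h_k^*(t)` plus the mean of `h_k^*` over `(0, t)`, summed over `k`.

If `q₀ = p < q₁`, take a finite `q ∈ (p, q₁)` and `r = r₁`. Now distribution functions are added:
truncation at height `α` and Chebyshev (`distribution_ell_le`) bound that of the `ℓ^q` norm by the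
individual ones plus averages over `(0, α)`.

In both cases Minkowski and Hardy in `L^R(dt/t)`, `R ≥ 1`, finish the estimate
(`mellinNorm_le_of_le_tsum_average`); the strict inequality makes the averaging kernel integrable.

If `q₀ = p = q₁`, the hypotheses force `r₀ ≤ p ≤ r₁`, and `r = p` works because `L^{p,p} = L^p`
commutes with `ℓ^p` by Tonelli. -/

theorem distribution_antitone (μ : Measure X) (g : X → ℝ≥0∞) : Antitone (distribution μ g) :=
  fun _ _ hab => measure_mono fun _ hx => lt_of_le_of_lt hab hx

theorem distribution_mono {g h : X → ℝ≥0∞} (hgh : ∀ x, g x ≤ h x) (α : ℝ≥0∞) :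
    distribution μ g α ≤ distribution μ h α :=
  measure_mono fun x hx => lt_of_lt_of_le hx (hgh x)

theorem rearrangement_antitone (μ : Measure X) (g : X → ℝ≥0∞) : Antitone (rearrangement μ g) :=
  fun _ _ hst => sInf_le_sInf fun _ hα => le_trans hα hst

theorem rearrangement_mono {g h : X → ℝ≥0∞} (hgh : ∀ x, g x ≤ h x) (t : ℝ≥0∞) :
    rearrangement μ g t ≤ rearrangement μ h t :=
  sInf_le_sInf fun α hα => le_trans (distribution_mono hgh α) hα

/-- The distribution function and the rearrangement are generalized inverses of each other. -/
theorem lt_rearrangement_iff (μ : Measure X) (g : X → ℝ≥0∞) (α t : ℝ≥0∞) :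
    α < rearrangement μ g t ↔ t < distribution μ g α := by
  constructor
  · intro h
    by_contra! hc
    exact absurd (sInf_le (show α ∈ {α : ℝ≥0∞ | distribution μ g α ≤ t} from hc)) (not_le.2 h)
  · intro h
    have hα : α < ∞ := by
      by_contra! hc
      have : α = ∞ := top_le_iff.1 hc
      simp [this, distribution] at h
    obtain ⟨u, hu, hmem, hlim⟩ := exists_seq_strictAnti_tendsto' hα
    have hset : {x | α < g x} = ⋃ n, {x | u n < g x} := by
      ext x
      simp only [mem_ofPred_eq, mem_iUnion]
      exact ⟨fun hx => (hlim.eventually_lt_const hx).exists,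
        fun ⟨n, hn⟩ => (hmem n).1.trans hn⟩
    have hmono : Monotone fun n => {x | u n < g x} := fun m n hmn x hx =>
      lt_of_le_of_lt (hu.antitone hmn) hx
    have hsup : distribution μ g α = ⨆ n, distribution μ g (u n) := by
      unfold distribution
      rw [hset, hmono.measure_iUnion]
    rw [hsup, lt_iSup_iff] at h
    obtain ⟨n, hn⟩ := h
    refine lt_of_lt_of_le (hmem n).1 (le_sInf fun β hβ => ?_)
    by_contra! hc
    exact absurd (lt_of_lt_of_le hn (distribution_antitone μ g hc.le)) (not_lt.2 hβ)

theorem rearrangement_le_iff (μ : Measure X) (g : X → ℝ≥0∞) (α t : ℝ≥0∞) :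
    rearrangement μ g t ≤ α ↔ distribution μ g α ≤ t := by
  rw [← not_lt, lt_rearrangement_iff, not_lt]

theorem measurable_rearrangement_ofReal (μ : Measure X) (g : X → ℝ≥0∞) :
    Measurable fun t : ℝ => rearrangement μ g (ENNReal.ofReal t) :=
  Antitone.measurable fun _ _ h => rearrangement_antitone μ g (ENNReal.ofReal_le_ofReal h)

theorem measurable_distribution_ofReal (μ : Measure X) (g : X → ℝ≥0∞) :
    Measurable fun t : ℝ => distribution μ g (ENNReal.ofReal t) :=
  Antitone.measurable fun _ _ h => distribution_antitone μ g (ENNReal.ofReal_le_ofReal h)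

theorem distribution_rpow (μ : Measure X) (g : X → ℝ≥0∞) {s : ℝ} (hs : 0 < s) (α : ℝ≥0∞) :
    distribution μ (fun x => g x ^ s) (α ^ s) = distribution μ g α := by
  simp only [distribution, ENNReal.rpow_lt_rpow_iff hs]

theorem rearrangement_rpow (μ : Measure X) (g : X → ℝ≥0∞) {s : ℝ} (hs : 0 < s) (t : ℝ≥0∞) :
    rearrangement μ (fun x => g x ^ s) t = rearrangement μ g t ^ s := by
  refine eq_of_forall_ge_iff fun β => ?_
  obtain ⟨α, rfl⟩ : ∃ α : ℝ≥0∞, β = α ^ s :=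
    ⟨β ^ s⁻¹, by rw [← ENNReal.rpow_mul, inv_mul_cancel₀ hs.ne', ENNReal.rpow_one]⟩
  rw [rearrangement_le_iff, distribution_rpow μ g hs, ENNReal.rpow_le_rpow_iff hs,
    rearrangement_le_iff]

end Rearrangement

/-! ### Integrals of powers. -/

section PowerIntegrals

/-- Writing a power as an integral over levels, with `x = ∞` allowed, prepares the later uses of
Tonelli. -/
theorem lintegral_Ioi_rpow_indicator_lt (x : ℝ≥0∞) {r : ℝ} (hr : 0 < r) :
    ∫⁻ α in Ioi (0 : ℝ), {α : ℝ | ENNReal.ofReal α < x}.indicator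
      (fun α => ENNReal.ofReal r * ENNReal.ofReal α ^ (r - 1)) α = x ^ r := by
  have hfin : ∀ y : ℝ≥0, ∫⁻ α in Ioi (0 : ℝ), {α : ℝ | ENNReal.ofReal α < y}.indicator
      (fun α => ENNReal.ofReal r * ENNReal.ofReal α ^ (r - 1)) α = (y : ℝ≥0∞) ^ r := by
    intro y
    -- The layer cake formula on a one-point space.
    have h := lintegral_rpow_eq_lintegral_meas_lt_mul (Measure.dirac ()) (f := fun _ => (y : ℝ))
      (Filter.Eventually.of_forall fun _ => y.2) aemeasurable_const hr
    rw [lintegral_dirac, ← ENNReal.ofReal_rpow_of_nonneg y.coe_nonneg hr.le,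
      ENNReal.ofReal_coe_nnreal] at h
    rw [h, ← lintegral_const_mul']
    · refine setLIntegral_congr_fun measurableSet_Ioi fun α hα => ?_
      have hα : 0 < α := hα
      have e : ENNReal.ofReal α < y ↔ α < y := by
        rw [← ENNReal.ofReal_coe_nnreal, ENNReal.ofReal_lt_ofReal_iff_of_nonneg hα.le]
      by_cases hy : α < y
      · simp [indicator, e, hy, ENNReal.ofReal_rpow_of_pos hα]
      · simp [indicator, e, hy]
    · exact ENNReal.ofReal_ne_top
  induction x with
  | coe y => exact hfin y
  | top =>
    rw [ENNReal.top_rpow_of_pos hr]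
    -- The finite value `c ^ r⁻¹` already contributes `c`, and the integrand increases with `x`.
    refine ENNReal.eq_top_of_forall_nnreal_le fun c => ?_
    have h := hfin (c ^ r⁻¹)
    rw [ENNReal.coe_rpow_of_nonneg _ (inv_nonneg.2 hr.le), ← ENNReal.rpow_mul,
      inv_mul_cancel₀ hr.ne', ENNReal.rpow_one] at h
    rw [← h]
    refine lintegral_mono fun α => indicator_le_indicator_of_subset ?_ (fun _ => zero_le) α
    exact fun α _ => ENNReal.ofReal_lt_top

theorem lintegral_Ioo_rpow_lt_top {a : ℝ} (ha : -1 < a) :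
    ∫⁻ s in Ioo (0 : ℝ) 1, ENNReal.ofReal s ^ a < ∞ := by
  have h := (intervalIntegral.integrableOn_Ioo_rpow_iff (s := a) zero_lt_one).2 ha
  have h2 := h.lintegral_lt_top
  refine lt_of_eq_of_lt (setLIntegral_congr_fun measurableSet_Ioo fun s hs => ?_) h2
  exact ENNReal.ofReal_rpow_of_pos hs.1

theorem ofReal_ne_zero_of_pos {t : ℝ} (ht : 0 < t) : ENNReal.ofReal t ≠ 0 := by simpa using ht

end PowerIntegrals

/-! ### Minkowski and Hardy inequalities in `L^R(dt/t)`. -/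

section MellinNorm

/-- The `L^R` quasi-norm on `(0, ∞)` with respect to the measure `dt / t`; for `R = ∞` the
supremum is taken over all points. -/
noncomputable def mellinNorm (R : ℝ≥0∞) (φ : ℝ → ℝ≥0∞) : ℝ≥0∞ :=
  if R = ∞ then ⨆ (t : ℝ) (_ : 0 < t), φ t
  else (∫⁻ t in Ioi (0 : ℝ), φ t ^ R.toReal / ENNReal.ofReal t) ^ (1 / R.toReal)

theorem mellinNorm_mono {R : ℝ≥0∞} {φ ψ : ℝ → ℝ≥0∞} (h : ∀ t, 0 < t → φ t ≤ ψ t) :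
    mellinNorm R φ ≤ mellinNorm R ψ := by
  unfold mellinNorm
  split_ifs with hR
  · exact iSup₂_mono h
  · refine ENNReal.rpow_le_rpow (setLIntegral_mono' measurableSet_Ioi fun t ht => ?_)
      (by positivity)
    gcongr
    exact h t ht

/-- Used to pass to an exponent at least one, where Minkowski is available. -/
theorem mellinNorm_rpow {R : ℝ≥0∞} {s : ℝ} (hs : 0 < s) (φ : ℝ → ℝ≥0∞) :
    mellinNorm (R / ENNReal.ofReal s) (fun t => φ t ^ s) = mellinNorm R φ ^ s := by
  have hs0 : ENNReal.ofReal s ≠ 0 := ofReal_ne_zero_of_pos hs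
  unfold mellinNorm
  by_cases hR : R = ∞
  · simp only [hR, ENNReal.top_div_of_ne_top ENNReal.ofReal_ne_top, if_true]
    exact ((ENNReal.orderIsoRpow s hs).map_iSup₂ fun (t : ℝ) (_ : 0 < t) => φ t).symm
  · have hR' : R / ENNReal.ofReal s ≠ ∞ := ENNReal.div_ne_top hR hs0
    rw [if_neg hR, if_neg hR', ENNReal.toReal_div, ENNReal.toReal_ofReal hs.le, ← ENNReal.rpow_mul]
    congr 1
    · refine lintegral_congr fun t => ?_
      rw [← ENNReal.rpow_mul, mul_div_cancel₀ _ hs.ne']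
    · rw [one_div_div, div_mul_eq_mul_div, one_mul]

/-- Minkowski for finite sums, then monotone convergence along finite subsets. -/
theorem mellinNorm_tsum_le {ι : Type*} [Countable ι] {R : ℝ≥0∞} (hR : 1 ≤ R)
    {φ : ι → ℝ → ℝ≥0∞} (hφ : ∀ k, Measurable (φ k)) :
    mellinNorm R (fun t => ∑' k, φ k t) ≤ ∑' k, mellinNorm R (φ k) := by
  unfold mellinNorm
  split_ifs with hRt
  · exact iSup₂_le fun t ht => ENNReal.tsum_le_tsum fun k =>
      le_iSup₂ (f := fun (t : ℝ) (_ : 0 < t) => φ k t) t ht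
  · set r := R.toReal with hr
    have hr1 : 1 ≤ r := by simpa using ENNReal.toReal_mono hRt hR
    have hr0 : 0 < r := by linarith
    set ν : Measure ℝ := (volume.restrict (Ioi (0 : ℝ))).withDensity
      (fun t => (ENNReal.ofReal t)⁻¹) with hν
    have hint : ∀ ψ : ℝ → ℝ≥0∞, Measurable ψ →
        ∫⁻ t in Ioi (0 : ℝ), ψ t ^ r / ENNReal.ofReal t = ∫⁻ t, ψ t ^ r ∂ν := by
      intro ψ hψ
      rw [hν, lintegral_withDensity_eq_lintegral_mul _ (by fun_prop) (by fun_prop)]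
      refine lintegral_congr fun t => ?_
      rw [Pi.mul_apply, mul_comm, div_eq_mul_inv]
    rw [hint _ (Measurable.tsum hφ)]
    simp_rw [fun k => hint _ (hφ k)]
    have hfin : ∀ s : Finset ι, (∫⁻ t, (∑ k ∈ s, φ k t) ^ r ∂ν) ^ (1 / r)
        ≤ ∑ k ∈ s, (∫⁻ t, φ k t ^ r ∂ν) ^ (1 / r) := by
      classical
      intro s
      induction s using Finset.induction_on with
      | empty => simp [hr0]
      | insert k s hk ih =>
        simp only [Finset.sum_insert hk]
        refine (ENNReal.lintegral_Lp_add_le (hφ k).aemeasurable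
          (Finset.measurable_fun_sum s fun k _ => hφ k).aemeasurable hr1).trans ?_
        gcongr
    have hsup : ∀ t, (∑' k, φ k t) ^ r = ⨆ s : Finset ι, (∑ k ∈ s, φ k t) ^ r := fun t => by
      rw [ENNReal.tsum_eq_iSup_sum]
      exact (ENNReal.orderIsoRpow r hr0).map_iSup _
    have hmono : Monotone fun (s : Finset ι) (t : ℝ) => (∑ k ∈ s, φ k t) ^ r :=
      fun s s' hss t => ENNReal.rpow_le_rpow (Finset.sum_le_sum_of_subset hss) hr0.le
    simp_rw [hsup]
    rw [lintegral_iSup_directed (fun s => by fun_prop) hmono.directed_le]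
    rw [one_div, ENNReal.rpow_inv_le_iff hr0]
    refine iSup_le fun s => ?_
    rw [← ENNReal.rpow_inv_le_iff hr0, ← one_div]
    exact (hfin s).trans (ENNReal.sum_le_tsum s)

theorem mellinNorm_add_le {R : ℝ≥0∞} (hR : 1 ≤ R) {φ ψ : ℝ → ℝ≥0∞} (hφ : Measurable φ)
    (hψ : Measurable ψ) :
    mellinNorm R (fun t => φ t + ψ t) ≤ mellinNorm R φ + mellinNorm R ψ := by
  have := mellinNorm_tsum_le (ι := Bool) hR (φ := fun b => cond b φ ψ)
    (by intro b; cases b <;> assumption)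
  simpa [tsum_bool, add_comm] using this

/-- Dilation invariance of `dt/t`. -/
theorem lintegral_Ioi_comp_mul_div (ψ : ℝ → ℝ≥0∞) {s : ℝ} (hs : 0 < s) :
    ∫⁻ t in Ioi (0 : ℝ), ψ (t * s) / ENNReal.ofReal t
      = ∫⁻ t in Ioi (0 : ℝ), ψ t / ENNReal.ofReal t := by
  have himg : (fun t : ℝ => t * s) '' Ioi 0 = Ioi 0 := by
    ext y
    simp only [mem_image, mem_Ioi]
    exact ⟨fun ⟨t, ht, h⟩ => h ▸ mul_pos ht hs,
      fun hy => ⟨y / s, div_pos hy hs, div_mul_cancel₀ y hs.ne'⟩⟩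
  have h := lintegral_image_eq_lintegral_abs_deriv_mul (s := Ioi (0 : ℝ)) measurableSet_Ioi
    (f := fun t => t * s) (f' := fun _ => s)
    (fun t _ => (by simpa using ((hasDerivAt_id t).mul_const s).hasDerivWithinAt))
    (fun a _ b _ hab => mul_right_cancel₀ hs.ne' hab) (fun t => ψ t / ENNReal.ofReal t)
  rw [himg] at h
  rw [h]
  refine setLIntegral_congr_fun measurableSet_Ioi fun t ht => ?_
  have ht : 0 < t := ht
  have hs0 := ofReal_ne_zero_of_pos hs
  simp only [abs_of_pos hs]
  rw [ENNReal.ofReal_mul ht.le, div_eq_mul_inv, div_eq_mul_inv,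
    ENNReal.mul_inv (Or.inl (ofReal_ne_zero_of_pos ht)) (Or.inl ENNReal.ofReal_ne_top)]
  rw [show ENNReal.ofReal s * (ψ (t * s) * ((ENNReal.ofReal t)⁻¹ * (ENNReal.ofReal s)⁻¹))
    = (ENNReal.ofReal s * (ENNReal.ofReal s)⁻¹) * (ψ (t * s) * (ENNReal.ofReal t)⁻¹) by ring,
    ENNReal.mul_inv_cancel hs0 ENNReal.ofReal_ne_top, one_mul]

/-- Hölder applied to `φ w = (φ^r w)^{1/r} · w^{1 - 1/r}`. -/
theorem lintegral_mul_rpow_le {Y : Type*} [MeasurableSpace Y] {ν : Measure Y} {φ w : Y → ℝ≥0∞}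
    (hφ : Measurable φ) (hw : Measurable w) {r : ℝ} (hr : 1 ≤ r) :
    (∫⁻ y, φ y * w y ∂ν) ^ r ≤ (∫⁻ y, φ y ^ r * w y ∂ν) * (∫⁻ y, w y ∂ν) ^ (r - 1) := by
  have hr0 : 0 < r := by linarith
  have h := ENNReal.lintegral_mul_norm_pow_le (μ := ν) (f := fun y => φ y ^ r * w y) (g := w)
    (p := r⁻¹) (q := 1 - r⁻¹) (by fun_prop) hw.aemeasurable (by positivity)
    (sub_nonneg.2 (inv_le_one_of_one_le₀ hr)) (by ring)
  have e : ∀ y, (φ y ^ r * w y) ^ r⁻¹ * w y ^ (1 - r⁻¹) = φ y * w y := by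
    intro y
    rw [ENNReal.mul_rpow_of_nonneg _ _ (by positivity), ← ENNReal.rpow_mul,
      mul_inv_cancel₀ hr0.ne', ENNReal.rpow_one, mul_assoc, ← ENNReal.rpow_add_of_nonneg _ _
      (by positivity) (sub_nonneg.2 (inv_le_one_of_one_le₀ hr))]
    simp
  simp_rw [e] at h
  refine (ENNReal.rpow_le_rpow h hr0.le).trans (le_of_eq ?_)
  rw [ENNReal.mul_rpow_of_nonneg _ _ hr0.le, ← ENNReal.rpow_mul, ← ENNReal.rpow_mul,
    inv_mul_cancel₀ hr0.ne', ENNReal.rpow_one]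
  congr 2
  field_simp

/-- Hardy's inequality for averaging operators that commute with dilations. -/
theorem mellinNorm_average_le {R : ℝ≥0∞} (hR : 1 ≤ R) {φ w : ℝ → ℝ≥0∞} (hφ : Measurable φ)
    (hw : Measurable w) :
    mellinNorm R (fun t => ∫⁻ s in Ioo (0 : ℝ) 1, φ (t * s) * w s)
      ≤ (∫⁻ s in Ioo (0 : ℝ) 1, w s) * mellinNorm R φ := by
  unfold mellinNorm
  split_ifs with hRt
  · refine iSup₂_le fun t ht => ?_
    rw [mul_comm, ← lintegral_const_mul _ hw]
    refine setLIntegral_mono' measurableSet_Ioo fun s hs => ?_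
    gcongr
    exact le_iSup₂ (f := fun (t : ℝ) (_ : 0 < t) => φ t) (t * s) (mul_pos ht hs.1)
  · set r := R.toReal with hr
    have hr1 : 1 ≤ r := by simpa using ENNReal.toReal_mono hRt hR
    have hr0 : 0 < r := by linarith
    set W := ∫⁻ s in Ioo (0 : ℝ) 1, w s with hW
    -- Hölder against the weight `w`, then Tonelli; dilation invariance removes `s` from the inner
    -- integral.
    have key : ∫⁻ t in Ioi (0 : ℝ), (∫⁻ s in Ioo (0 : ℝ) 1, φ (t * s) * w s) ^ r / ENNReal.ofReal t
        ≤ W ^ r * ∫⁻ t in Ioi (0 : ℝ), φ t ^ r / ENNReal.ofReal t := by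
      calc ∫⁻ t in Ioi (0 : ℝ), (∫⁻ s in Ioo (0 : ℝ) 1, φ (t * s) * w s) ^ r / ENNReal.ofReal t
          ≤ ∫⁻ t in Ioi (0 : ℝ), ∫⁻ s in Ioo (0 : ℝ) 1,
              W ^ (r - 1) * (w s * (φ (t * s) ^ r / ENNReal.ofReal t)) := by
            refine lintegral_mono fun t => ?_
            have h := lintegral_mul_rpow_le (ν := volume.restrict (Ioo (0 : ℝ) 1))
              (φ := fun s => φ (t * s)) (by fun_prop) hw hr1
            refine (ENNReal.div_le_div_right h _).trans (le_of_eq ?_)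
            rw [mul_comm, div_eq_mul_inv, mul_assoc, ← lintegral_mul_const _ (by fun_prop),
              ← lintegral_const_mul _ (by fun_prop)]
            refine lintegral_congr fun s => ?_
            rw [div_eq_mul_inv]
            ring
        _ = ∫⁻ s in Ioo (0 : ℝ) 1, ∫⁻ t in Ioi (0 : ℝ),
              W ^ (r - 1) * (w s * (φ (t * s) ^ r / ENNReal.ofReal t)) := by
            refine lintegral_lintegral_swap ?_
            fun_prop
        _ = ∫⁻ s in Ioo (0 : ℝ) 1,
              W ^ (r - 1) * (w s * ∫⁻ t in Ioi (0 : ℝ), φ t ^ r / ENNReal.ofReal t) := by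
            refine setLIntegral_congr_fun measurableSet_Ioo fun s hs => ?_
            rw [lintegral_const_mul _ (by fun_prop), lintegral_const_mul _ (by fun_prop),
              lintegral_Ioi_comp_mul_div (fun t => φ t ^ r) hs.1]
        _ = W ^ r * ∫⁻ t in Ioi (0 : ℝ), φ t ^ r / ENNReal.ofReal t := by
            rw [lintegral_const_mul _ (by fun_prop), lintegral_mul_const _ hw, ← hW, ← mul_assoc]
            congr 1
            nth_rewrite 2 [← ENNReal.rpow_one W]
            rw [← ENNReal.rpow_add_of_nonneg _ _ (by linarith) zero_le_one, sub_add_cancel]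
    refine (ENNReal.rpow_le_rpow key (by positivity)).trans (le_of_eq ?_)
    rw [ENNReal.mul_rpow_of_nonneg _ _ (by positivity), ← ENNReal.rpow_mul,
      mul_one_div_cancel hr0.ne', ENNReal.rpow_one]

end MellinNorm

/-! ### Two forms of the Lorentz quasi-norm and its monotonicity in the second exponent. -/

section LorentzNorm

variable {X : Type*} [MeasurableSpace X] {μ : Measure X}

theorem rpow_mul_rpow_div_ofReal {t : ℝ} (ht : 0 < t) (y : ℝ≥0∞) (b : ℝ) {r : ℝ} (hr : 0 ≤ r) :
    (ENNReal.ofReal t ^ b * y) ^ r / ENNReal.ofReal t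
      = ENNReal.ofReal t ^ (b * r - 1) * y ^ r := by
  have ht0 := ofReal_ne_zero_of_pos ht
  rw [ENNReal.mul_rpow_of_nonneg _ _ hr, ← ENNReal.rpow_mul,
    ENNReal.rpow_sub _ _ ht0 ENNReal.ofReal_ne_top, ENNReal.rpow_one, div_eq_mul_inv,
    div_eq_mul_inv]
  ring

theorem lorentzNorm_eq_mellinNorm (μ : Measure X) (p r : ℝ≥0∞) (g : X → ℝ≥0∞) :
    lorentzNorm μ p r g = (if r = ∞ then 1 else (r / p) ^ (1 / r.toReal)) * mellinNorm r
      (fun t => ENNReal.ofReal t ^ (1 / p.toReal) * rearrangement μ g (ENNReal.ofReal t)) := by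
  unfold lorentzNorm mellinNorm
  split_ifs with h
  · rw [one_mul]
  · rw [ENNReal.mul_rpow_of_nonneg _ _ (by positivity)]

theorem lorentzNorm_mono (p r : ℝ≥0∞) {g h : X → ℝ≥0∞} (hgh : ∀ x, g x ≤ h x) :
    lorentzNorm μ p r g ≤ lorentzNorm μ p r h := by
  rw [lorentzNorm_eq_mellinNorm, lorentzNorm_eq_mellinNorm]
  gcongr
  refine mellinNorm_mono fun t _ => ?_
  gcongr
  exact rearrangement_mono hgh _

/-- Both sides integrate `a t^{a-1} · r α^{r-1}` over the same planar region, since `α < g^*(t)`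
means `t < μ_g(α)`. -/
theorem lintegral_rearrangement_eq_lintegral_distribution (μ : Measure X) (g : X → ℝ≥0∞) {a r : ℝ}
    (ha : 0 < a) (hr : 0 < r) :
    ENNReal.ofReal a * ∫⁻ t in Ioi (0 : ℝ), ENNReal.ofReal t ^ (a - 1) *
        rearrangement μ g (ENNReal.ofReal t) ^ r
      = ENNReal.ofReal r * ∫⁻ α in Ioi (0 : ℝ), ENNReal.ofReal α ^ (r - 1) *
        distribution μ g (ENNReal.ofReal α) ^ a := by
  have hm := measurable_rearrangement_ofReal μ g
  have hd := measurable_distribution_ofReal μ g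
  set u : ℝ → ℝ≥0∞ := fun t => ENNReal.ofReal a * ENNReal.ofReal t ^ (a - 1) with hu
  set v : ℝ → ℝ≥0∞ := fun t => ENNReal.ofReal r * ENNReal.ofReal t ^ (r - 1) with hv
  have hum : Measurable u := by fun_prop
  have hvm : Measurable v := by fun_prop
  calc _ = ∫⁻ t in Ioi (0 : ℝ), u t * rearrangement μ g (ENNReal.ofReal t) ^ r := by
        rw [← lintegral_const_mul _ (by fun_prop)]
        refine lintegral_congr fun t => ?_
        rw [hu, mul_assoc]
    _ = ∫⁻ t in Ioi (0 : ℝ), ∫⁻ α in Ioi (0 : ℝ),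
          {q : ℝ × ℝ | ENNReal.ofReal q.1 < rearrangement μ g (ENNReal.ofReal q.2)}.indicator
            (fun q => u q.2 * v q.1) (α, t) := by
        refine lintegral_congr fun t => ?_
        rw [← lintegral_Ioi_rpow_indicator_lt _ hr, ← lintegral_const_mul]
        · refine lintegral_congr fun α => ?_
          by_cases h : ENNReal.ofReal α < rearrangement μ g (ENNReal.ofReal t) <;>
            simp [indicator, h, hv]
        · exact hvm.indicator (measurableSet_lt (by fun_prop) measurable_const)
    _ = ∫⁻ α in Ioi (0 : ℝ), ∫⁻ t in Ioi (0 : ℝ),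
          {q : ℝ × ℝ | ENNReal.ofReal q.1 < rearrangement μ g (ENNReal.ofReal q.2)}.indicator
            (fun q => u q.2 * v q.1) (α, t) := by
        refine lintegral_lintegral_swap (Measurable.aemeasurable ?_)
        refine Measurable.comp (g := {q : ℝ × ℝ | ENNReal.ofReal q.1 <
          rearrangement μ g (ENNReal.ofReal q.2)}.indicator (fun q => u q.2 * v q.1))
          (f := fun q : ℝ × ℝ => (q.2, q.1)) ?_ (by fun_prop)
        refine Measurable.indicator (by fun_prop) (measurableSet_lt (by fun_prop) ?_)
        exact hm.comp measurable_snd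
    _ = ∫⁻ α in Ioi (0 : ℝ), v α * distribution μ g (ENNReal.ofReal α) ^ a := by
        refine lintegral_congr fun α => ?_
        rw [← lintegral_Ioi_rpow_indicator_lt _ ha, ← lintegral_const_mul]
        · refine lintegral_congr fun t => ?_
          by_cases h : ENNReal.ofReal t < distribution μ g (ENNReal.ofReal α) <;>
            simp [indicator, h, hu, lt_rearrangement_iff, mul_comm]
        · exact hum.indicator (measurableSet_lt (by fun_prop) measurable_const)
    _ = _ := by
        rw [← lintegral_const_mul _ (by fun_prop)]
        refine lintegral_congr fun t => ?_
        rw [hv, mul_assoc]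

/-- Any `y` below one factor yields a test point for the other supremum: `α = y` in one direction,
`t = y^{1/b}` in the other. -/
theorem iSup_rearrangement_eq_iSup_distribution (μ : Measure X) (g : X → ℝ≥0∞) {b : ℝ}
    (hb : 0 < b) :
    ⨆ (t : ℝ) (_ : 0 < t), ENNReal.ofReal t ^ b * rearrangement μ g (ENNReal.ofReal t)
      = ⨆ (α : ℝ) (_ : 0 < α), ENNReal.ofReal α * distribution μ g (ENNReal.ofReal α) ^ b := by
  apply le_antisymm
  · refine iSup₂_le fun t ht => ENNReal.mul_le_of_forall_lt fun x hx y hy => ?_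
    rcases eq_or_ne y 0 with rfl | hy0
    · simp
    have hyt : y ≠ ∞ := hy.ne_top
    refine le_trans ?_ (le_iSup₂ (f := fun (α : ℝ) (_ : 0 < α) =>
      ENNReal.ofReal α * distribution μ g (ENNReal.ofReal α) ^ b) y.toReal
      (ENNReal.toReal_pos hy0 hyt))
    rw [ENNReal.ofReal_toReal hyt, mul_comm]
    gcongr
    refine hx.le.trans ?_
    gcongr
    exact ((lt_rearrangement_iff μ g _ _).1 hy).le
  · refine iSup₂_le fun α hα => ENNReal.mul_le_of_forall_lt fun x hx y hy => ?_
    rcases eq_or_ne y 0 with rfl | hy0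
    · simp
    have hyt : y ≠ ∞ := hy.ne_top
    have hz0 : y ^ b⁻¹ ≠ 0 := by simp [hy0, hyt]
    have hzt : y ^ b⁻¹ ≠ ∞ := ENNReal.rpow_ne_top_of_nonneg (by positivity) hyt
    refine le_trans ?_ (le_iSup₂ (f := fun (t : ℝ) (_ : 0 < t) =>
      ENNReal.ofReal t ^ b * rearrangement μ g (ENNReal.ofReal t)) (y ^ b⁻¹).toReal
      (ENNReal.toReal_pos hz0 hzt))
    rw [ENNReal.ofReal_toReal hzt, ← ENNReal.rpow_mul, inv_mul_cancel₀ hb.ne', ENNReal.rpow_one,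
      mul_comm]
    gcongr
    refine hx.le.trans ((lt_rearrangement_iff μ g _ _).2 ?_).le
    rwa [ENNReal.rpow_inv_lt_iff hb]

/-- The Lorentz quasi-norm in terms of the distribution function. -/
theorem lorentzNorm_eq_mellinNorm_distribution (μ : Measure X) {p r : ℝ≥0∞} (hp : 0 < p)
    (hp' : p < ∞) (hr : 0 < r) (g : X → ℝ≥0∞) :
    lorentzNorm μ p r g = (if r = ∞ then 1 else r ^ (1 / r.toReal)) * mellinNorm r
      (fun α => ENNReal.ofReal α * distribution μ g (ENNReal.ofReal α) ^ (1 / p.toReal)) := by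
  have hpr : 0 < p.toReal := ENNReal.toReal_pos hp.ne' hp'.ne
  unfold lorentzNorm mellinNorm
  split_ifs with h
  · rw [one_mul, iSup_rearrangement_eq_iSup_distribution μ g (by positivity)]
  · have hrr : 0 < r.toReal := ENNReal.toReal_pos hr.ne' h
    rw [← ENNReal.mul_rpow_of_nonneg _ _ (by positivity)]
    congr 1
    have h1 := lintegral_rearrangement_eq_lintegral_distribution μ g
      (a := 1 / p.toReal * r.toReal) (by positivity) hrr
    have e : r / p = ENNReal.ofReal (1 / p.toReal * r.toReal) := by
      rw [one_div_mul_eq_div, ENNReal.ofReal_div_of_pos hpr, ENNReal.ofReal_toReal h,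
        ENNReal.ofReal_toReal hp'.ne]
    rw [e, setLIntegral_congr_fun measurableSet_Ioi
      fun t ht => rpow_mul_rpow_div_ofReal ht _ _ hrr.le, h1, ENNReal.ofReal_toReal h]
    congr 1
    refine setLIntegral_congr_fun measurableSet_Ioi fun t ht => ?_
    have := rpow_mul_rpow_div_ofReal ht
      (distribution μ g (ENNReal.ofReal t) ^ (1 / p.toReal)) 1 hrr.le
    rw [ENNReal.rpow_one, one_mul] at this
    simp only
    rw [this, ← ENNReal.rpow_mul]

/-- Restrict the integral to `s < t`, where `g^*(s) ≥ g^*(t)`; the normalisation `r/p` makes the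
constant exactly one. -/
theorem rpow_mul_rearrangement_le_lorentzNorm (μ : Measure X) {p r : ℝ≥0∞} (hp : 0 < p)
    (hp' : p < ∞) (hr : 0 < r) (g : X → ℝ≥0∞) {t : ℝ} (ht : 0 < t) :
    ENNReal.ofReal t ^ (1 / p.toReal) * rearrangement μ g (ENNReal.ofReal t)
      ≤ lorentzNorm μ p r g := by
  have hpr : 0 < p.toReal := ENNReal.toReal_pos hp.ne' hp'.ne
  unfold lorentzNorm
  split_ifs with h
  · exact le_iSup₂ (f := fun (t : ℝ) (_ : 0 < t) =>
      ENNReal.ofReal t ^ (1 / p.toReal) * rearrangement μ g (ENNReal.ofReal t)) t ht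
  have hrr : 0 < r.toReal := ENNReal.toReal_pos hr.ne' h
  have hm := measurable_rearrangement_ofReal μ g
  have e : r / p = ENNReal.ofReal (1 / p.toReal * r.toReal) := by
    rw [one_div_mul_eq_div, ENNReal.ofReal_div_of_pos hpr, ENNReal.ofReal_toReal h,
      ENNReal.ofReal_toReal hp'.ne]
  have ha : 0 < 1 / p.toReal * r.toReal := by positivity
  rw [one_div r.toReal, ENNReal.le_rpow_inv_iff hrr, ENNReal.mul_rpow_of_nonneg _ _ hrr.le,
    ← ENNReal.rpow_mul, e, setLIntegral_congr_fun measurableSet_Ioi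
      fun t ht => rpow_mul_rpow_div_ofReal ht _ _ hrr.le]
  rw [← lintegral_Ioi_rpow_indicator_lt _ ha, ← lintegral_const_mul _ (by fun_prop),
    ← lintegral_mul_const]
  · refine lintegral_mono fun s => ?_
    by_cases hs : ENNReal.ofReal s < ENNReal.ofReal t
    · simp only [indicator, mem_ofPred_eq, hs, if_true, mul_assoc]
      gcongr
      exact rearrangement_antitone μ g hs.le
    · simp [indicator, hs]
  · exact Measurable.indicator (by fun_prop) (measurableSet_lt (by fun_prop) measurable_const)

/-- Split off the power `r₁ - r₀` of the integrand and bound it pointwise by the `r₀`-norm; what is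
left is the `r₀`-integral. -/
theorem exists_lorentzNorm_le_of_le {p r₀ r₁ : ℝ≥0∞} (hp : 0 < p) (hp' : p < ∞) (hr₀ : 0 < r₀)
    (hr : r₀ ≤ r₁) :
    ∃ C : ℝ≥0, ∀ (X : Type*) [MeasurableSpace X] (μ : Measure X) (g : X → ℝ≥0∞),
      lorentzNorm μ p r₁ g ≤ C * lorentzNorm μ p r₀ g := by
  have hpr : 0 < p.toReal := ENNReal.toReal_pos hp.ne' hp'.ne
  by_cases h1 : r₁ = ∞
  · refine ⟨1, fun X _ μ g => ?_⟩
    rw [h1, lorentzNorm, if_pos rfl, ENNReal.coe_one, one_mul]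
    exact iSup₂_le fun t ht => rpow_mul_rearrangement_le_lorentzNorm μ hp hp' hr₀ g ht
  have h0 : r₀ ≠ ∞ := ne_top_of_le_ne_top h1 hr
  have hr₁ : 0 < r₁ := hr₀.trans_le hr
  have hs0 : 0 < r₀.toReal := ENNReal.toReal_pos hr₀.ne' h0
  have hs1 : 0 < r₁.toReal := ENNReal.toReal_pos hr₁.ne' h1
  have hs : r₀.toReal ≤ r₁.toReal := ENNReal.toReal_mono h1 hr
  have hfin : (r₁ / r₀) ^ (1 / r₁.toReal) ≠ ∞ :=
    ENNReal.rpow_ne_top_of_nonneg (by positivity) (ENNReal.div_ne_top h1 hr₀.ne')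
  refine ⟨((r₁ / r₀) ^ (1 / r₁.toReal)).toNNReal, fun X _ μ g => ?_⟩
  rw [ENNReal.coe_toNNReal hfin]
  set N := lorentzNorm μ p r₀ g with hN
  set I := ∫⁻ t in Ioi (0 : ℝ),
      (ENNReal.ofReal t ^ (1 / p.toReal) * rearrangement μ g (ENNReal.ofReal t)) ^ r₀.toReal
        / ENNReal.ofReal t with hI
  have hm := measurable_rearrangement_ofReal μ g
  have hNI : N ^ r₀.toReal = r₀ / p * I := by
    rw [hN, lorentzNorm, if_neg h0, ← ENNReal.rpow_mul, one_div_mul_cancel hs0.ne',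
      ENNReal.rpow_one]
  rw [lorentzNorm, if_neg h1, one_div r₁.toReal, ENNReal.rpow_inv_le_iff hs1,
    ENNReal.mul_rpow_of_nonneg _ _ hs1.le, ← ENNReal.rpow_mul, inv_mul_cancel₀ hs1.ne',
    ENNReal.rpow_one]
  calc r₁ / p * ∫⁻ t in Ioi (0 : ℝ),
      (ENNReal.ofReal t ^ (1 / p.toReal) * rearrangement μ g (ENNReal.ofReal t)) ^ r₁.toReal
        / ENNReal.ofReal t
      ≤ r₁ / p * ∫⁻ t in Ioi (0 : ℝ), N ^ (r₁.toReal - r₀.toReal) *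
      ((ENNReal.ofReal t ^ (1 / p.toReal) * rearrangement μ g (ENNReal.ofReal t)) ^ r₀.toReal
        / ENNReal.ofReal t) := by
        refine mul_le_mul' le_rfl ?_
        refine setLIntegral_mono' measurableSet_Ioi fun t ht => ?_
        rw [← mul_div_assoc]
        gcongr
        have e : ∀ x : ℝ≥0∞, x ^ r₁.toReal = x ^ (r₁.toReal - r₀.toReal) * x ^ r₀.toReal := by
          intro x
          rw [← ENNReal.rpow_add_of_nonneg _ _ (sub_nonneg.2 hs) hs0.le, sub_add_cancel]
        rw [e]
        refine mul_le_mul' (ENNReal.rpow_le_rpow ?_ (sub_nonneg.2 hs)) le_rfl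
        exact rpow_mul_rearrangement_le_lorentzNorm μ hp hp' hr₀ g ht
    _ = r₁ / p * (N ^ (r₁.toReal - r₀.toReal) * I) := by
        rw [lintegral_const_mul _ (by fun_prop)]
    _ = r₁ / r₀ * (N ^ (r₁.toReal - r₀.toReal) * (r₀ / p * I)) := by
        rw [show r₁ / r₀ * (N ^ (r₁.toReal - r₀.toReal) * (r₀ / p * I))
          = r₁ / r₀ * (r₀ / p) * (N ^ (r₁.toReal - r₀.toReal) * I) by ring,
          ← mul_div_assoc, ENNReal.div_mul_cancel hr₀.ne' h0]
    _ = r₁ / r₀ * N ^ r₁.toReal := by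
        rw [← hNI, ← ENNReal.rpow_add_of_nonneg _ _ (sub_nonneg.2 hs) hs0.le, sub_add_cancel]

end LorentzNorm

/-! ### Layer cake formulas and the excess above `h^*(t)`. -/

section LayerCake

variable {X : Type*} [MeasurableSpace X] {μ : Measure X}

theorem lintegral_rpow_eq_lintegral_distribution {g : X → ℝ≥0∞} (hg : AEMeasurable g μ)
    (hfin : ∀ᵐ x ∂μ, g x ≠ ∞) {q : ℝ} (hq : 0 < q) :
    ENNReal.ofReal q * ∫⁻ β in Ioi (0 : ℝ),
      ENNReal.ofReal β ^ (q - 1) * distribution μ g (ENNReal.ofReal β)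
      = ∫⁻ x, g x ^ q ∂μ := by
  have h := lintegral_rpow_eq_lintegral_meas_lt_mul μ (f := fun x => (g x).toReal)
    (Filter.Eventually.of_forall fun _ => ENNReal.toReal_nonneg) hg.ennreal_toReal hq
  have h1 : ∫⁻ x, g x ^ q ∂μ = ∫⁻ x, ENNReal.ofReal ((g x).toReal ^ q) ∂μ := by
    refine lintegral_congr_ae ?_
    filter_upwards [hfin] with x hx
    rw [← ENNReal.ofReal_rpow_of_nonneg ENNReal.toReal_nonneg hq.le, ENNReal.ofReal_toReal hx]
  rw [h1, h]
  congr 1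
  refine setLIntegral_congr_fun measurableSet_Ioi fun β hβ => ?_
  have hβ : 0 < β := hβ
  rw [mul_comm, ENNReal.ofReal_rpow_of_pos hβ]
  congr 1
  refine measure_congr ?_
  filter_upwards [hfin] with x hx
  exact propext (ENNReal.ofReal_lt_iff_lt_toReal hβ.le hx)

/-- As an inequality, no finiteness of `g` is needed: an infinite right side is trivial, a finite
one makes `g` finite almost everywhere. -/
theorem lintegral_distribution_le_lintegral_rpow {g : X → ℝ≥0∞} (hg : AEMeasurable g μ)
    {q : ℝ} (hq : 0 < q) :
    ENNReal.ofReal q * ∫⁻ β in Ioi (0 : ℝ),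
      ENNReal.ofReal β ^ (q - 1) * distribution μ g (ENNReal.ofReal β)
      ≤ ∫⁻ x, g x ^ q ∂μ := by
  by_cases hfin : ∫⁻ x, g x ^ q ∂μ = ∞
  · rw [hfin]
    exact le_top
  · refine (lintegral_rpow_eq_lintegral_distribution hg ?_ hq).le
    filter_upwards [ae_lt_top' (hg.pow_const q) hfin] with x hx hx'
    simp [hx', hq] at hx

/-- The part of the integral of `h` above the level `h^*(t)` is controlled by `∫_0^t h^*`. -/
theorem lintegral_sub_rearrangement_le {h : X → ℝ≥0∞} (hh : Measurable h) (hfin : ∀ x, h x ≠ ∞)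
    (t : ℝ) :
    ∫⁻ x, (h x - rearrangement μ h (ENNReal.ofReal t)) ∂μ
      ≤ ∫⁻ s in Ioo (0 : ℝ) t, rearrangement μ h (ENNReal.ofReal s) := by
  set α := rearrangement μ h (ENNReal.ofReal t) with hα
  have hm := measurable_rearrangement_ofReal μ h
  have h1 := lintegral_rpow_eq_lintegral_distribution (μ := μ) (g := fun x => h x - α) (q := 1)
    (hh.sub_const α).aemeasurable
    (Filter.Eventually.of_forall fun x => ne_top_of_le_ne_top (hfin x) tsub_le_self) one_pos
  have h2 := lintegral_distribution_le_lintegral_rpow (μ := volume.restrict (Ioo (0 : ℝ) t))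
    (g := fun s => rearrangement μ h (ENNReal.ofReal s) - α) (q := 1)
    (hm.sub_const α).aemeasurable one_pos
  simp only [sub_self, ENNReal.rpow_zero, one_mul, ENNReal.rpow_one, ENNReal.ofReal_one] at h1 h2
  rw [← h1]
  refine le_trans ?_ (h2.trans (lintegral_mono fun s => tsub_le_self))
  -- The comparison is made level by level: the excess of `h` on `X` against the excess of `h^*` on
  -- `(0, t)`.
  refine setLIntegral_mono' measurableSet_Ioi fun β hβ => ?_
  have hβ : 0 < β := hβ
  rcases eq_or_ne α ∞ with htop | htop
  · simp [distribution, htop]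
  have e1 : distribution μ (fun x => h x - α) (ENNReal.ofReal β)
      = distribution μ h (ENNReal.ofReal β + α) := by
    simp only [distribution, lt_tsub_iff_right]
  have hle : distribution μ h (ENNReal.ofReal β + α) ≤ ENNReal.ofReal t := by
    rw [← rearrangement_le_iff, ← hα]
    exact le_add_self
  set m := distribution μ h (ENNReal.ofReal β + α) with hmdef
  have hmt : m ≠ ∞ := ne_top_of_le_ne_top ENNReal.ofReal_ne_top hle
  -- The interval `(0, m)` lies where `h^*` exceeds `β + α`, and `m ≤ t` since this level is at
  -- least `h^*(t)`.
  have e2 : Ioo (0 : ℝ) m.toReal ⊆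
      {s | ENNReal.ofReal β < rearrangement μ h (ENNReal.ofReal s) - α} ∩ Ioo (0 : ℝ) t := by
    intro s hs
    have hsm : ENNReal.ofReal s < m := (ENNReal.ofReal_lt_iff_lt_toReal hs.1.le hmt).2 hs.2
    refine ⟨?_, hs.1, (ENNReal.ofReal_lt_ofReal_iff_of_nonneg hs.1.le).1 (hsm.trans_le hle)⟩
    rw [mem_ofPred_eq, lt_tsub_iff_right, lt_rearrangement_iff]
    exact hsm
  rw [e1, distribution, Measure.restrict_apply' measurableSet_Ioo]
  refine le_trans ?_ (measure_mono e2)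
  rw [Real.volume_Ioo, sub_zero, ENNReal.ofReal_toReal hmt]

end LayerCake

/-! ### Countable sums: rearrangements and distribution functions. -/

section Sums

variable {X : Type*} [MeasurableSpace X] {μ : Measure X}

theorem setLIntegral_Ioo_eq_mul_comp_mul (ψ : ℝ → ℝ≥0∞) {t : ℝ} (ht : 0 < t) :
    ∫⁻ u in Ioo (0 : ℝ) t, ψ u = ENNReal.ofReal t * ∫⁻ s in Ioo (0 : ℝ) 1, ψ (t * s) := by
  have himg : (fun s : ℝ => t * s) '' Ioo 0 1 = Ioo 0 t := by
    rw [image_mul_left_Ioo ht, mul_zero, mul_one]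
  have h := lintegral_image_eq_lintegral_abs_deriv_mul (s := Ioo (0 : ℝ) 1) measurableSet_Ioo
    (f := fun s => t * s) (f' := fun _ => t)
    (fun s _ => (by simpa using ((hasDerivAt_id s).const_mul t).hasDerivWithinAt))
    (fun a _ b _ hab => mul_left_cancel₀ ht.ne' hab) ψ
  rw [himg] at h
  rw [h, lintegral_const_mul' _ _ ENNReal.ofReal_ne_top, abs_of_pos ht]

/-- Chebyshev; `I = 0` and `I = ∞` are separate because `I / (I / t)` does not simplify there. -/
theorem distribution_div_le {S : X → ℝ≥0∞} (hS : Measurable S) {I : ℝ≥0∞}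
    (hI : ∫⁻ x, S x ∂μ ≤ I) {t : ℝ≥0∞} (ht : t ≠ 0) (ht' : t ≠ ∞) :
    distribution μ S (I / t) ≤ t := by
  unfold distribution
  rcases eq_or_ne I ∞ with rfl | hIt
  · simp [ENNReal.top_div_of_ne_top ht']
  rcases eq_or_ne I 0 with rfl | hI0
  · have h0 : S =ᵐ[μ] 0 := (lintegral_eq_zero_iff hS).1 (le_antisymm hI zero_le)
    have : μ {x | 0 / t < S x} = 0 := by
      refine measure_mono_null (fun x hx => ?_) (ae_iff.1 h0)
      rw [mem_ofPred_eq, ENNReal.zero_div] at hx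
      exact hx.ne'
    rw [this]
    exact zero_le
  · have hd0 : I / t ≠ 0 := by simp [hI0, ht']
    have hdt : I / t ≠ ∞ := ENNReal.div_ne_top hIt ht
    calc μ {x | I / t < S x} ≤ μ {x | I / t ≤ S x} :=
          measure_mono (ofPred_subset_ofPred.2 fun _ hx => hx.le)
      _ ≤ (∫⁻ x, S x ∂μ) / (I / t) := meas_ge_le_lintegral_div hS.aemeasurable hd0 hdt
      _ ≤ I / (I / t) := by gcongr
      _ = t := ENNReal.div_div_cancel hI0 hIt

/-- With `α_k = h_k^*(t)`, the sum is at most `∑ α_k + ∑ (h_k - α_k)₊`. The excess has integral at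
most `∑ J_k`, so it exceeds `(∑ J_k)/t` only on a set of measure at most `t`. -/
theorem rearrangement_tsum_le {ι : Type*} [Countable ι] {h : ι → X → ℝ≥0∞}
    (hh : ∀ k, Measurable (h k)) (hfin : ∀ k x, h k x ≠ ∞) {t : ℝ} (ht : 0 < t) :
    rearrangement μ (fun x => ∑' k, h k x) (ENNReal.ofReal t)
      ≤ ∑' k, (rearrangement μ (h k) (ENNReal.ofReal t) +
        (∫⁻ s in Ioo (0 : ℝ) t, rearrangement μ (h k) (ENNReal.ofReal s)) / ENNReal.ofReal t) := by
  set α : ι → ℝ≥0∞ := fun k => rearrangement μ (h k) (ENNReal.ofReal t) with hα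
  set J : ι → ℝ≥0∞ := fun k => ∫⁻ s in Ioo (0 : ℝ) t, rearrangement μ (h k) (ENNReal.ofReal s)
  have hsum : ∑' k, (α k + J k / ENNReal.ofReal t)
      = ∑' k, α k + (∑' k, J k) / ENNReal.ofReal t := by
    simp only [div_eq_mul_inv]
    rw [ENNReal.tsum_add, ENNReal.tsum_mul_right]
  rw [hsum, rearrangement_le_iff]
  have hSm : Measurable fun x => ∑' k, (h k x - α k) := Measurable.tsum fun k => (hh k).sub_const _
  have hS : ∫⁻ x, ∑' k, (h k x - α k) ∂μ ≤ ∑' k, J k := by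
    rw [lintegral_tsum fun k => ((hh k).sub_const _).aemeasurable]
    exact ENNReal.tsum_le_tsum fun k => lintegral_sub_rearrangement_le (hh k) (hfin k) t
  refine le_trans (measure_mono fun x hx => ?_)
    (distribution_div_le hSm hS (ofReal_ne_zero_of_pos ht) ENNReal.ofReal_ne_top)
  have hx : ∑' k, α k + (∑' k, J k) / ENNReal.ofReal t < ∑' k, h k x := hx
  have hle : ∑' k, h k x ≤ ∑' k, α k + ∑' k, (h k x - α k) := by
    rw [← ENNReal.tsum_add]
    exact ENNReal.tsum_le_tsum fun k => le_add_tsub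
  exact lt_of_add_lt_add_left (hx.trans_le hle)

theorem mellinNorm_le_of_le_tsum_average {ι : Type*} [Countable ι] {R : ℝ≥0∞} (hR : 1 ≤ R)
    {φ : ι → ℝ → ℝ≥0∞} {w Φ : ℝ → ℝ≥0∞} (hφm : ∀ k, Measurable (φ k)) (hwm : Measurable w)
    (key : ∀ t, 0 < t → Φ t ≤ ∑' k, (φ k t + ∫⁻ s in Ioo (0 : ℝ) 1, φ k (t * s) * w s)) :
    mellinNorm R Φ ≤ (1 + ∫⁻ s in Ioo (0 : ℝ) 1, w s) * ∑' k, mellinNorm R (φ k) := by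
  have hAm : ∀ k, Measurable fun t => ∫⁻ s in Ioo (0 : ℝ) 1, φ k (t * s) * w s := fun k => by
    have h1 : Measurable (Function.uncurry fun t s : ℝ => φ k (t * s) * w s) :=
      ((hφm k).comp (measurable_fst.mul measurable_snd)).mul (hwm.comp measurable_snd)
    exact h1.lintegral_prod_right
  calc _ ≤ mellinNorm R (fun t => ∑' k, (φ k t + ∫⁻ s in Ioo (0 : ℝ) 1, φ k (t * s) * w s)) :=
        mellinNorm_mono key
    _ ≤ ∑' k, mellinNorm R (fun t => φ k t + ∫⁻ s in Ioo (0 : ℝ) 1, φ k (t * s) * w s) :=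
        mellinNorm_tsum_le hR fun k => (hφm k).add (hAm k)
    _ ≤ ∑' k, (1 + ∫⁻ s in Ioo (0 : ℝ) 1, w s) * mellinNorm R (φ k) := by
        refine ENNReal.tsum_le_tsum fun k => ?_
        rw [add_mul, one_mul]
        exact (mellinNorm_add_le hR (hφm k) (hAm k)).trans
          (add_le_add le_rfl (mellinNorm_average_le hR (hφm k) hwm))
    _ = _ := ENNReal.tsum_mul_left

/-- The triangle inequality, up to a constant, for the functional
`‖t^b h^*(t)‖_{L^R(dt/t)}` with `b < 1 ≤ R`. -/
theorem mellinNorm_rearrangement_tsum_le {ι : Type*} [Countable ι] {h : ι → X → ℝ≥0∞}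
    (hh : ∀ k, Measurable (h k)) (hfin : ∀ k x, h k x ≠ ∞) {R : ℝ≥0∞} (hR : 1 ≤ R) (b : ℝ) :
    mellinNorm R (fun t => ENNReal.ofReal t ^ b *
        rearrangement μ (fun x => ∑' k, h k x) (ENNReal.ofReal t))
      ≤ (1 + ∫⁻ s in Ioo (0 : ℝ) 1, ENNReal.ofReal s ^ (-b)) *
        ∑' k, mellinNorm R (fun t => ENNReal.ofReal t ^ b *
          rearrangement μ (h k) (ENNReal.ofReal t)) := by
  set φ : ι → ℝ → ℝ≥0∞ := fun k t =>
    ENNReal.ofReal t ^ b * rearrangement μ (h k) (ENNReal.ofReal t) with hφ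
  have hm := fun k => measurable_rearrangement_ofReal μ (h k)
  have hφm : ∀ k, Measurable (φ k) := fun k => by
    have := hm k
    fun_prop
  set w : ℝ → ℝ≥0∞ := fun s => ENNReal.ofReal s ^ (-b) with hw
  have hwm : Measurable w := by fun_prop
  have key : ∀ t, 0 < t → ENNReal.ofReal t ^ b *
      rearrangement μ (fun x => ∑' k, h k x) (ENNReal.ofReal t)
      ≤ ∑' k, (φ k t + ∫⁻ s in Ioo (0 : ℝ) 1, φ k (t * s) * w s) := by
    intro t ht
    have ht0 := ofReal_ne_zero_of_pos ht
    refine (mul_le_mul' le_rfl (rearrangement_tsum_le hh hfin ht)).trans (le_of_eq ?_)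
    rw [← ENNReal.tsum_mul_left]
    refine tsum_congr fun k => ?_
    rw [mul_add]
    congr 1
    -- Substituting `u = ts` cancels the division by `t`, and `t^b = (ts)^b s^{-b}` produces the
    -- kernel.
    rw [setLIntegral_Ioo_eq_mul_comp_mul _ ht, mul_comm (ENNReal.ofReal t), mul_div_assoc,
      ENNReal.div_self ht0 ENNReal.ofReal_ne_top, mul_one, ← lintegral_const_mul']
    · refine setLIntegral_congr_fun measurableSet_Ioo fun s hs => ?_
      have hs0 := ofReal_ne_zero_of_pos hs.1
      simp only [hφ, hw]
      rw [ENNReal.ofReal_mul ht.le, ENNReal.mul_rpow_of_ne_top ENNReal.ofReal_ne_top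
        ENNReal.ofReal_ne_top, ENNReal.rpow_neg]
      rw [show ∀ a b c : ℝ≥0∞, a * b * c * b⁻¹ = a * c * (b * b⁻¹) by intros; ring,
        ENNReal.mul_inv_cancel (by simp [hs.1]) (by simp [hs.1]), mul_one]
    · simp [ht]
  exact mellinNorm_le_of_le_tsum_average hR hφm hwm key

/-- Truncation at `α` keeps the distribution function below `α` and kills it from `α` on. -/
theorem lintegral_min_rpow_eq {g : X → ℝ≥0∞} (hg : Measurable g) {q : ℝ} (hq : 0 < q) (α : ℝ) :
    ∫⁻ x, min (g x) (ENNReal.ofReal α) ^ q ∂μ = ENNReal.ofReal q * ∫⁻ β in Ioo (0 : ℝ) α,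
      ENNReal.ofReal β ^ (q - 1) * distribution μ g (ENNReal.ofReal β) := by
  rw [← lintegral_rpow_eq_lintegral_distribution (hg.min measurable_const).aemeasurable
    (Filter.Eventually.of_forall fun x => ne_top_of_le_ne_top ENNReal.ofReal_ne_top
      (min_le_right _ _)) hq]
  congr 1
  rw [← Ioi_inter_Iio, inter_comm, ← setLIntegral_indicator measurableSet_Iio]
  refine setLIntegral_congr_fun measurableSet_Ioi fun β hβ => ?_
  have hβ : 0 < β := hβ
  have e : ENNReal.ofReal β < ENNReal.ofReal α ↔ β < α :=
    ENNReal.ofReal_lt_ofReal_iff_of_nonneg hβ.le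
  by_cases h : β < α <;> simp [indicator, distribution, e, h]

/-- Either some `g_k` exceeds `α`, or no truncation at `α` changes anything and Chebyshev applies to
the truncated sum at level `α^q`. -/
theorem distribution_ell_le {ι : Type*} [Countable ι] {g : ι → X → ℝ≥0∞}
    (hg : ∀ k, Measurable (g k)) {q : ℝ} (hq : 0 < q) {α : ℝ} (hα : 0 < α) :
    distribution μ (fun x => (∑' k, g k x ^ q) ^ (1 / q)) (ENNReal.ofReal α)
      ≤ ∑' k, (distribution μ (g k) (ENNReal.ofReal α) +
        (∫⁻ x, min (g k x) (ENNReal.ofReal α) ^ q ∂μ) / ENNReal.ofReal α ^ q) := by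
  have hα0 := ofReal_ne_zero_of_pos hα
  have hm : ∀ k, Measurable fun x => min (g k x) (ENNReal.ofReal α) ^ q := fun k => by
    have := hg k
    fun_prop
  have hsub : {x | ENNReal.ofReal α < (∑' k, g k x ^ q) ^ (1 / q)} ⊆
      (⋃ k, {x | ENNReal.ofReal α < g k x}) ∪
        {x | ENNReal.ofReal α ^ q ≤ ∑' k, min (g k x) (ENNReal.ofReal α) ^ q} := by
    intro x hx
    have hx : ENNReal.ofReal α < (∑' k, g k x ^ q) ^ (1 / q) := hx
    by_cases h : ∃ k, ENNReal.ofReal α < g k x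
    · exact Or.inl (mem_iUnion.2 h)
    · push Not at h
      refine Or.inr ?_
      rw [mem_ofPred_eq]
      simp_rw [fun k => min_eq_left (h k)]
      rw [one_div, ENNReal.lt_rpow_inv_iff hq] at hx
      exact hx.le
  unfold distribution
  refine (measure_mono hsub).trans ((measure_union_le _ _).trans ?_)
  rw [ENNReal.tsum_add]
  refine add_le_add (measure_iUnion_le _) ?_
  refine (meas_ge_le_lintegral_div (Measurable.tsum hm).aemeasurable (by simp [hα])
    (by simp [hq.le])).trans (le_of_eq ?_)
  rw [lintegral_tsum fun k => (hm k).aemeasurable]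
  simp only [div_eq_mul_inv]
  rw [ENNReal.tsum_mul_right]

/-- The kernel `q s^{q-1-p}` is the layer cake density on `(0, α)` rescaled to `(0, 1)`; it is
integrable when `p < q`. -/
theorem mellinNorm_distribution_ell_le {ι : Type*} [Countable ι] {g : ι → X → ℝ≥0∞}
    (hg : ∀ k, Measurable (g k)) {R : ℝ≥0∞} (hR : 1 ≤ R) {p q : ℝ} (hq : 0 < q) :
    mellinNorm R (fun α => ENNReal.ofReal α ^ p *
        distribution μ (fun x => (∑' k, g k x ^ q) ^ (1 / q)) (ENNReal.ofReal α))
      ≤ (1 + ∫⁻ s in Ioo (0 : ℝ) 1, ENNReal.ofReal q * ENNReal.ofReal s ^ (q - 1 - p)) *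
        ∑' k, mellinNorm R (fun α => ENNReal.ofReal α ^ p *
          distribution μ (g k) (ENNReal.ofReal α)) := by
  set φ : ι → ℝ → ℝ≥0∞ := fun k t =>
    ENNReal.ofReal t ^ p * distribution μ (g k) (ENNReal.ofReal t) with hφ
  have hm := fun k => measurable_distribution_ofReal μ (g k)
  have hφm : ∀ k, Measurable (φ k) := fun k => by
    have := hm k
    fun_prop
  set w : ℝ → ℝ≥0∞ := fun s => ENNReal.ofReal q * ENNReal.ofReal s ^ (q - 1 - p) with hw
  have hwm : Measurable w := by fun_prop
  have key : ∀ t, 0 < t → ENNReal.ofReal t ^ p *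
      distribution μ (fun x => (∑' k, g k x ^ q) ^ (1 / q)) (ENNReal.ofReal t)
      ≤ ∑' k, (φ k t + ∫⁻ s in Ioo (0 : ℝ) 1, φ k (t * s) * w s) := by
    intro t ht
    have ht0 := ofReal_ne_zero_of_pos ht
    refine (mul_le_mul' le_rfl (distribution_ell_le hg hq ht)).trans (le_of_eq ?_)
    rw [← ENNReal.tsum_mul_left]
    refine tsum_congr fun k => ?_
    rw [mul_add]
    congr 1
    rw [lintegral_min_rpow_eq (hg k) hq, setLIntegral_Ioo_eq_mul_comp_mul _ ht,
      show ∀ a b c d e : ℝ≥0∞, a * (b * (c * d) / e) = (a * b * c / e) * d by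
        intros; simp only [div_eq_mul_inv]; ring, ← lintegral_const_mul']
    · refine setLIntegral_congr_fun measurableSet_Ioo fun s hs => ?_
      have hs0 := ofReal_ne_zero_of_pos hs.1
      simp only [hφ, hw]
      rw [ENNReal.ofReal_mul ht.le, ENNReal.mul_rpow_of_ne_top ENNReal.ofReal_ne_top
        ENNReal.ofReal_ne_top, ENNReal.mul_rpow_of_ne_top ENNReal.ofReal_ne_top
        ENNReal.ofReal_ne_top, ENNReal.rpow_sub _ p hs0 ENNReal.ofReal_ne_top,
        ENNReal.rpow_sub q 1 ht0 ENNReal.ofReal_ne_top, ENNReal.rpow_one]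
      set T := ENNReal.ofReal t
      set S := ENNReal.ofReal s ^ (q - 1)
      set D := distribution μ (g k) (T * ENNReal.ofReal s)
      simp only [div_eq_mul_inv]
      rw [show T ^ p * ENNReal.ofReal q * T * (T ^ q)⁻¹ * (T ^ q * T⁻¹ * S * D)
        = (T * T⁻¹) * (T ^ q * (T ^ q)⁻¹) * (T ^ p * ENNReal.ofReal q * S * D) by ring,
        show T ^ p * ENNReal.ofReal s ^ p * D *
          (ENNReal.ofReal q * (S * (ENNReal.ofReal s ^ p)⁻¹))
        = (ENNReal.ofReal s ^ p * (ENNReal.ofReal s ^ p)⁻¹) *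
          (T ^ p * ENNReal.ofReal q * S * D) by ring,
        ENNReal.mul_inv_cancel ht0 ENNReal.ofReal_ne_top,
        ENNReal.mul_inv_cancel (by simp [T, ht]) (by simp [T, ht]),
        ENNReal.mul_inv_cancel (by simp [hs.1]) (by simp [hs.1]), one_mul]
    · refine ENNReal.div_ne_top (ENNReal.mul_ne_top (ENNReal.mul_ne_top ?_ ?_) ?_) ?_ <;> simp [ht]
  exact mellinNorm_le_of_le_tsum_average hR hφm hwm key

end Sums

/-! ### The three model estimates and the embedding. -/

section Embedding

theorem ellNorm_const_mul {ι : Type*} {q : ℝ≥0∞} (hq : 0 < q) (hq' : q ≠ ∞) (c : ℝ≥0∞)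
    (a : ι → ℝ≥0∞) : ellNorm q (fun k => c * a k) = c * ellNorm q a := by
  have hs : 0 < q.toReal := ENNReal.toReal_pos hq.ne' hq'
  simp only [ellNorm, if_neg hq', ENNReal.mul_rpow_of_nonneg _ _ hs.le]
  rw [ENNReal.tsum_mul_left, ENNReal.mul_rpow_of_nonneg _ _ (by positivity), ← ENNReal.rpow_mul,
    mul_one_div_cancel hs.ne', ENNReal.rpow_one]

theorem ellNorm_mono {ι : Type*} (q : ℝ≥0∞) {a b : ι → ℝ≥0∞} (h : ∀ k, a k ≤ b k) :
    ellNorm q a ≤ ellNorm q b := by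
  unfold ellNorm
  split_ifs
  · exact iSup_mono h
  · exact ENNReal.rpow_le_rpow (ENNReal.tsum_le_tsum fun k =>
      ENNReal.rpow_le_rpow (h k) ENNReal.toReal_nonneg) (by positivity)

theorem ellNorm_rpow {ι : Type*} {q : ℝ≥0∞} (hq : 0 < q) (hq' : q ≠ ∞) (a : ι → ℝ≥0∞) :
    ellNorm q a ^ q.toReal = ∑' k, a k ^ q.toReal := by
  have hs : 0 < q.toReal := ENNReal.toReal_pos hq.ne' hq'
  rw [ellNorm, if_neg hq', ← ENNReal.rpow_mul, one_div_mul_cancel hs.ne', ENNReal.rpow_one]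

theorem le_ellNorm {ι : Type*} {q : ℝ≥0∞} (hq : 0 < q) (a : ι → ℝ≥0∞) (k : ι) :
    a k ≤ ellNorm q a := by
  by_cases hq' : q = ∞
  · rw [ellNorm, if_pos hq']
    exact le_iSup a k
  · have hs : 0 < q.toReal := ENNReal.toReal_pos hq.ne' hq'
    rw [← ENNReal.rpow_le_rpow_iff hs, ellNorm_rpow hq hq']
    exact ENNReal.le_tsum (f := fun k => a k ^ q.toReal) k

theorem ellNorm_le_of_le {ι : Type*} {q q' : ℝ≥0∞} (hq : 0 < q) (h : q ≤ q') (a : ι → ℝ≥0∞) :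
    ellNorm q' a ≤ ellNorm q a := by
  by_cases hq' : q' = ∞
  · rw [ellNorm, if_pos hq']
    exact iSup_le fun k => le_ellNorm hq a k
  have hqt : q ≠ ∞ := ne_top_of_le_ne_top hq' h
  have hs : 0 < q.toReal := ENNReal.toReal_pos hq.ne' hqt
  have hle : q.toReal ≤ q'.toReal := ENNReal.toReal_mono hq' h
  have e : ∀ x : ℝ≥0∞, x ^ q'.toReal = x ^ (q'.toReal - q.toReal) * x ^ q.toReal := fun x => by
    rw [← ENNReal.rpow_add_of_nonneg _ _ (sub_nonneg.2 hle) hs.le, sub_add_cancel]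
  rw [← ENNReal.rpow_le_rpow_iff (hs.trans_le hle), ellNorm_rpow (hq.trans_le h) hq', e,
    ellNorm_rpow hq hqt, ← ENNReal.tsum_mul_left]
  refine ENNReal.tsum_le_tsum fun k => ?_
  rw [e]
  exact mul_le_mul' (ENNReal.rpow_le_rpow (le_ellNorm hq a k) (sub_nonneg.2 hle)) le_rfl

/-- Takes the `q`-th root of an additive estimate; `c` stands for the normalising factor of the
Lorentz quasi-norm. -/
theorem le_mul_ellNorm_of_rpow_le {ι : Type*} {q : ℝ≥0∞} (hq : 0 < q) (hq' : q ≠ ∞)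
    {c K M : ℝ≥0∞} {N : ι → ℝ≥0∞} (h : M ^ q.toReal ≤ K * ∑' k, N k ^ q.toReal) :
    c * M ≤ K ^ (1 / q.toReal) * ellNorm q fun k => c * N k := by
  have hs : 0 < q.toReal := ENNReal.toReal_pos hq.ne' hq'
  rw [ellNorm_const_mul hq hq', mul_left_comm]
  refine mul_le_mul' le_rfl ?_
  rw [← ENNReal.rpow_le_rpow_iff hs, ENNReal.mul_rpow_of_nonneg _ _ hs.le, ellNorm_rpow hq hq',
    ← ENNReal.rpow_mul, one_div_mul_cancel hs.ne', ENNReal.rpow_one]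
  exact h

theorem exists_lorentzNorm_ellNorm_le_of_lt {p q r : ℝ≥0∞} (hp' : p < ∞)
    (hq : 0 < q) (hqp : q < p) (hqr : q ≤ r) :
    ∃ C : ℝ≥0, ∀ (X : Type*) [MeasurableSpace X] (μ : Measure X) (ι : Type*) [Countable ι]
      (g : ι → X → ℝ≥0∞), (∀ k, Measurable (g k)) → (∀ k x, g k x ≠ ∞) →
      lorentzNorm μ p r (fun x => ellNorm q fun k => g k x)
        ≤ C * ellNorm q fun k => lorentzNorm μ p r (g k) := by
  have hqt : q ≠ ∞ := (hqp.trans hp').ne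
  have hs : 0 < q.toReal := ENNReal.toReal_pos hq.ne' hqt
  have hsp : q.toReal < p.toReal := ENNReal.toReal_strict_mono hp'.ne hqp
  have hpr : 0 < p.toReal := hs.trans hsp
  -- This is where `q < p` enters: the Hardy kernel `s^{-q/p}` is integrable.
  have hb : -1 < -(1 / p.toReal * q.toReal) := by
    rw [one_div_mul_eq_div, neg_lt_neg_iff, div_lt_one hpr]
    exact hsp
  set K : ℝ≥0∞ := 1 + ∫⁻ s in Ioo (0 : ℝ) 1, ENNReal.ofReal s ^ (-(1 / p.toReal * q.toReal))
    with hK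
  have hKt : K ≠ ∞ := ENNReal.add_ne_top.2 ⟨ENNReal.one_ne_top, (lintegral_Ioo_rpow_lt_top hb).ne⟩
  have hC : K ^ (1 / q.toReal) ≠ ∞ := ENNReal.rpow_ne_top_of_nonneg (by positivity) hKt
  refine ⟨(K ^ (1 / q.toReal)).toNNReal, fun X _ μ ι _ g hg hfin => ?_⟩
  rw [ENNReal.coe_toNNReal hC]
  simp only [lorentzNorm_eq_mellinNorm]
  refine le_mul_ellNorm_of_rpow_le hq hqt ?_
  have hR : 1 ≤ r / ENNReal.ofReal q.toReal := by
    rw [ENNReal.ofReal_toReal hqt, ENNReal.le_div_iff_mul_le (Or.inl hq.ne') (Or.inl hqt), one_mul]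
    exact hqr
  have hpow : ∀ h : X → ℝ≥0∞, (fun t => (ENNReal.ofReal t ^ (1 / p.toReal) *
      rearrangement μ h (ENNReal.ofReal t)) ^ q.toReal) = fun t =>
      ENNReal.ofReal t ^ (1 / p.toReal * q.toReal) *
        rearrangement μ (fun x => h x ^ q.toReal) (ENNReal.ofReal t) := fun h => by
    funext t
    rw [ENNReal.mul_rpow_of_nonneg _ _ hs.le, ← ENNReal.rpow_mul, rearrangement_rpow μ h hs]
  simp only [← mellinNorm_rpow hs, hpow, ellNorm_rpow hq hqt]
  exact mellinNorm_rearrangement_tsum_le (h := fun k x => g k x ^ q.toReal)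
    (fun k => (hg k).pow_const _)
    (fun k x => ENNReal.rpow_ne_top_of_nonneg hs.le (hfin k x)) hR _

/-- In the distribution form, the `p`-th power makes the norm linear in `μ_g`, so distribution
functions can be summed in `L^{r/p}(dα/α)`. -/
theorem exists_lorentzNorm_ellNorm_le_of_gt {p q r : ℝ≥0∞} (hp : 0 < p)
    (hq' : q ≠ ∞) (hpq : p < q) (hpr : p ≤ r) :
    ∃ C : ℝ≥0, ∀ (X : Type*) [MeasurableSpace X] (μ : Measure X) (ι : Type*) [Countable ι]
      (g : ι → X → ℝ≥0∞), (∀ k, Measurable (g k)) →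
      lorentzNorm μ p r (fun x => ellNorm q fun k => g k x)
        ≤ C * ellNorm p fun k => lorentzNorm μ p r (g k) := by
  have hpt : p ≠ ∞ := (hpq.trans_le le_top).ne
  have hs : 0 < p.toReal := ENNReal.toReal_pos hp.ne' hpt
  have hsq : p.toReal < q.toReal := ENNReal.toReal_strict_mono hq' hpq
  have hq0 : 0 < q.toReal := hs.trans hsq
  set K : ℝ≥0∞ := 1 + ∫⁻ s in Ioo (0 : ℝ) 1,
    ENNReal.ofReal q.toReal * ENNReal.ofReal s ^ (q.toReal - 1 - p.toReal) with hK
  have hKt : K ≠ ∞ := by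
    refine ENNReal.add_ne_top.2 ⟨ENNReal.one_ne_top, ?_⟩
    rw [lintegral_const_mul' _ _ ENNReal.ofReal_ne_top]
    exact ENNReal.mul_ne_top ENNReal.ofReal_ne_top (lintegral_Ioo_rpow_lt_top (by linarith)).ne
  have hC : K ^ (1 / p.toReal) ≠ ∞ := ENNReal.rpow_ne_top_of_nonneg (by positivity) hKt
  refine ⟨(K ^ (1 / p.toReal)).toNNReal, fun X _ μ ι _ g hg => ?_⟩
  rw [ENNReal.coe_toNNReal hC]
  simp only [lorentzNorm_eq_mellinNorm_distribution μ hp hpt.lt_top (hp.trans_le hpr)]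
  refine le_mul_ellNorm_of_rpow_le hp hpt ?_
  have hR : 1 ≤ r / ENNReal.ofReal p.toReal := by
    rw [ENNReal.ofReal_toReal hpt, ENNReal.le_div_iff_mul_le (Or.inl hp.ne') (Or.inl hpt), one_mul]
    exact hpr
  have hpow : ∀ h : X → ℝ≥0∞, (fun α => (ENNReal.ofReal α *
      distribution μ h (ENNReal.ofReal α) ^ (1 / p.toReal)) ^ p.toReal) = fun α =>
      ENNReal.ofReal α ^ p.toReal * distribution μ h (ENNReal.ofReal α) := fun h => by
    funext t
    rw [ENNReal.mul_rpow_of_nonneg _ _ hs.le, ← ENNReal.rpow_mul, one_div_mul_cancel hs.ne',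
      ENNReal.rpow_one]
  simp only [← mellinNorm_rpow hs, hpow, ellNorm, if_neg hq']
  exact mellinNorm_distribution_ell_le hg hR hq0

theorem lorentzNorm_self_rpow {X : Type*} [MeasurableSpace X] (μ : Measure X) {p : ℝ≥0∞}
    (hp : 0 < p) (hp' : p < ∞) (g : X → ℝ≥0∞) :
    lorentzNorm μ p p g ^ p.toReal = ENNReal.ofReal p.toReal * ∫⁻ β in Ioi (0 : ℝ),
      ENNReal.ofReal β ^ (p.toReal - 1) * distribution μ g (ENNReal.ofReal β) := by
  have hs : 0 < p.toReal := ENNReal.toReal_pos hp.ne' hp'.ne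
  rw [lorentzNorm_eq_mellinNorm_distribution μ hp hp' hp, if_neg hp'.ne, mellinNorm,
    if_neg hp'.ne, ENNReal.mul_rpow_of_nonneg _ _ hs.le, ← ENNReal.rpow_mul, ← ENNReal.rpow_mul,
    one_div_mul_cancel hs.ne', ENNReal.rpow_one, ENNReal.rpow_one, ENNReal.ofReal_toReal hp'.ne]
  congr 1
  refine setLIntegral_congr_fun measurableSet_Ioi fun t ht => ?_
  have := rpow_mul_rpow_div_ofReal ht
    (distribution μ g (ENNReal.ofReal t) ^ (1 / p.toReal)) 1 hs.le
  rw [ENNReal.rpow_one, one_mul, ← ENNReal.rpow_mul, one_div_mul_cancel hs.ne',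
    ENNReal.rpow_one] at this
  exact this

/-- By the layer cake formula `L^{p,p}` is `L^p`, and sum and integral commute. -/
theorem lorentzNorm_ellNorm_self_le {X ι : Type*} [MeasurableSpace X] [Countable ι]
    (μ : Measure X) {p : ℝ≥0∞} (hp : 0 < p) (hp' : p < ∞) {g : ι → X → ℝ≥0∞}
    (hg : ∀ k, Measurable (g k)) (hfin : ∀ k x, g k x ≠ ∞) :
    lorentzNorm μ p p (fun x => ellNorm p fun k => g k x)
      ≤ ellNorm p fun k => lorentzNorm μ p p (g k) := by
  have hs : 0 < p.toReal := ENNReal.toReal_pos hp.ne' hp'.ne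
  have hm : Measurable fun x => ellNorm p fun k => g k x := by
    simp only [ellNorm, if_neg hp'.ne]
    exact (Measurable.tsum fun k => (hg k).pow_const _).pow_const _
  rw [← ENNReal.rpow_le_rpow_iff hs, ellNorm_rpow hp hp'.ne, lorentzNorm_self_rpow μ hp hp']
  refine (lintegral_distribution_le_lintegral_rpow hm.aemeasurable hs).trans (le_of_eq ?_)
  simp only [ellNorm_rpow hp hp'.ne]
  rw [lintegral_tsum fun k => ((hg k).pow_const _).aemeasurable]
  refine tsum_congr fun k => ?_
  rw [lorentzNorm_self_rpow μ hp hp', lintegral_rpow_eq_lintegral_distribution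
    (hg k).aemeasurable (Filter.Eventually.of_forall (hfin k)) hs]

/-- It suffices to bound `L^{p,r}(ℓ^q)` by `ℓ^{q₀}(L^{p,r})` for some `q ≤ q₁` and
`r₀ ≤ r ≤ r₁`. -/
theorem exists_lorentzEllNorm_le_of_intermediate.{u, v, w} {p q₀ q₁ q r₀ r₁ r : ℝ≥0∞} (hp : 0 < p)
    (hp' : p < ∞) (hq₀ : 0 < q₀) (hq₀t : q₀ ≠ ∞) (hr₀ : 0 < r₀) (hq0 : 0 < q) (hqq₁ : q ≤ q₁)
    (hr0 : r₀ ≤ r) (hr1 : r ≤ r₁)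
    (h : ∃ C : ℝ≥0, ∀ (X : Type u) [MeasurableSpace X] (μ : Measure X) (ι : Type v) [Countable ι]
      (g : ι → X → ℝ≥0∞), (∀ k, Measurable (g k)) → (∀ k x, g k x ≠ ∞) →
      lorentzNorm μ p r (fun x => ellNorm q fun k => g k x)
        ≤ C * ellNorm q₀ fun k => lorentzNorm μ p r (g k)) :
    ∃ C : ℝ≥0, ∀ (X : Type u) [MeasurableSpace X] (μ : Measure X), IsNonatomic μ →
      ∀ (ι : Type v) [Countable ι] (𝕜 : Type w) [RCLike 𝕜] (f : ι → X → 𝕜),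
        (∀ k, Measurable (f k)) →
          lorentzEllNorm μ p r₁ q₁ f ≤ C * ellLorentzNorm μ q₀ p r₀ f := by
  obtain ⟨C, hC⟩ := h
  obtain ⟨C₁, hC₁⟩ := exists_lorentzNorm_le_of_le hp hp' (hr₀.trans_le hr0) hr1
  obtain ⟨C₀, hC₀⟩ := exists_lorentzNorm_le_of_le hp hp' hr₀ hr0
  refine ⟨C₁ * (C * C₀), fun X _ μ _ ι _ 𝕜 _ f hf => ?_⟩
  unfold lorentzEllNorm ellLorentzNorm
  calc _ ≤ C₁ * lorentzNorm μ p r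
          (fun x => ellNorm q₁ fun k => ‖f k x‖ₑ) := hC₁ X μ _
    _ ≤ C₁ * lorentzNorm μ p r
          (fun x => ellNorm q fun k => ‖f k x‖ₑ) :=
        mul_le_mul' le_rfl (lorentzNorm_mono p r fun x =>
          ellNorm_le_of_le hq0 hqq₁ _)
    _ ≤ C₁ * (C * ellNorm q₀ fun k =>
          lorentzNorm μ p r fun x => ‖f k x‖ₑ) :=
        mul_le_mul' le_rfl (hC X μ ι (fun k x => ‖f k x‖ₑ) (fun k => (hf k).enorm)
          fun k x => enorm_ne_top)
    _ ≤ C₁ * (C * ellNorm q₀ fun k =>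
          C₀ * lorentzNorm μ p r₀ fun x => ‖f k x‖ₑ) :=
        mul_le_mul' le_rfl (mul_le_mul' le_rfl
          (ellNorm_mono q₀ fun k => hC₀ X μ _))
    _ = _ := by
        rw [ellNorm_const_mul hq₀ hq₀t]
        push_cast
        ring

end Embedding

end LorentzSeq

theorem proposition4p1 (p q₀ q₁ r₀ r₁ : ℝ≥0∞)
    (hp : 0 < p) (hp' : p < ∞)
    (hq₀ : 0 < q₀) (hq₁ : 0 < q₁) (hr₀ : 0 < r₀) (hr₁ : 0 < r₁)
    (hq : q₀ ≤ min p (min q₁ r₁)) (hr : r₀ ≤ r₁)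
    (hcases : p ≠ q₁ ∨ (p = q₁ ∧ r₀ ≤ q₁) ∨ (q₀ < p ∧ p = q₁ ∧ q₁ < r₀)) :
    ∃ C : ℝ≥0, ∀ (X : Type*) [MeasurableSpace X] (μ : Measure X), LorentzSeq.IsNonatomic μ →
      ∀ (ι : Type*) [Countable ι] (𝕜 : Type*) [RCLike 𝕜] (f : ι → X → 𝕜),
        (∀ k, Measurable (f k)) →
          LorentzSeq.lorentzEllNorm μ p r₁ q₁ f ≤ C * LorentzSeq.ellLorentzNorm μ q₀ p r₀ f := by
  obtain ⟨hqp, hqq, hqr⟩ : q₀ ≤ p ∧ q₀ ≤ q₁ ∧ q₀ ≤ r₁ := by simpa only [le_min_iff] using hq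
  have hq₀t : q₀ ≠ ∞ := (hqp.trans_lt hp').ne
  rcases hqp.lt_or_eq with hlt | rfl
  · exact LorentzSeq.exists_lorentzEllNorm_le_of_intermediate hp hp' hq₀ hq₀t hr₀ hq₀ hqq hr le_rfl
      (LorentzSeq.exists_lorentzNorm_ellNorm_le_of_lt hp' hq₀ hlt hqr)
  · rcases hqq.lt_or_eq with hlt | rfl
    -- As `q₁` may be infinite, a finite exponent strictly above `p` is used instead.
    · obtain ⟨q, hq0, hq1⟩ := exists_between hlt
      refine LorentzSeq.exists_lorentzEllNorm_le_of_intermediate hp hp' hq₀ hq₀t hr₀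
        (hq₀.trans hq0) hq1.le hr le_rfl ?_
      obtain ⟨C, hC⟩ := LorentzSeq.exists_lorentzNorm_ellNorm_le_of_gt hq₀ hq1.ne_top hq0 hqr
      exact ⟨C, fun X _ μ ι _ g hg _ => hC X μ ι g hg⟩
    -- With `q₀ = p = q₁` only case (ii) survives, so `p` itself lies between `r₀` and `r₁`.
    · have hr₀q : r₀ ≤ q₀ := by
        rcases hcases with h | h | h
        · exact absurd rfl h
        · exact h.2
        · exact absurd h.1 (lt_irrefl _)
      refine LorentzSeq.exists_lorentzEllNorm_le_of_intermediate hp hp' hq₀ hq₀t hr₀ hq₀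
        le_rfl hr₀q hqr ⟨1, fun X _ μ ι _ g hg hfin => ?_⟩
      rw [ENNReal.coe_one, one_mul]
      exact LorentzSeq.lorentzNorm_ellNorm_self_le μ hq₀ hp' hg hfin
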